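/- Let $\mathbb{C}\langle \mathbf{x}\rangle=\mathbb{C}\langle x_1,\dots,x_d\rangle$ be the $*$-algebra of polynomials in $d$ non-commuting self-adjoint variables. A functional is a unital linear map $\mathbb{C}\langle\mathbf{x}\rangle\to\mathbb{C}$; a state is a functional $\phi$ with $\phi[P^*]=\overline{\phi[P]}$ and $\phi[P^*P]\ge 0$ for all $P$. For $\mathbf{a}\in\mathbb{R}^d$, $\delta_{\mathbf{a}}[P]=P(a_1,\dots,a_d)$. In non-commuting indeterminates, let $M^\phi(\mathbf{w})=\sum_{|\vec u|\ge 1}\phi[x_{\vec u}]w_{\vec u}$ and $(1+M)\mathbf{w}=((1+M)w_1,\dots,(1+M)w_d)$, and define the Boolean, free and conditionally free cumulant generating functions by $$\eta^\phi=1-(1+M^\phi)^{-1},\qquad M^\psi(\mathbf{w})=R^\psi\bigl((1+M^\psi(\mathbf{w}))\mathbf{w}\bigr),\qquad \eta^\phi(\mathbf{w})=(1+M^\psi(\mathbf{w}))^{-1}R^{\phi,\psi}\bigl((1+M^\psi(\mathbf{w}))\mathbf{w}\bigr).$$ The functionals $\phi\boxplus\psi$, $\phi^{\boxplus t}$, $\phi\uplus\psi$,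 $\phi^{\uplus t}$ ($t\in\mathbb{R}$) are determined by $R^{\phi\boxplus\psi}=R^\phi+R^\psi$, $R^{\phi^{\boxplus t}}=tR^\phi$, $\eta^{\phi\uplus\psi}=\eta^\phi+\eta^\psi$, $\eta^{\phi^{\uplus t}}=t\eta^\phi$. A functional $\rho$ is a freely infinitely divisible state if $\rho_t:=\rho^{\boxplus t}$ is a state for every $t\ge 0$. The functional $\Phi[\rho,\psi]$ is determined by $$\eta^{\Phi[\rho,\psi]}(\mathbf{w})=(1+M^\psi(\mathbf{w}))^{-1}R^\rho\bigl((1+M^\psi(\mathbf{w}))\mathbf{w}\bigr).$$ For $t\ne-1$ let $\mathfrak{B}_{\mathbf{a},t}[\phi]=\bigl((\phi^{\boxplus(1+t)}\boxplus\delta_{\mathbf{a}})\uplus\delta_{-\mathbf{a}}\bigr)^{\uplus 1/(1+t)}$ and $\mathfrak{B}_t[\phi]=(\phi^{\boxplus(1+t)})^{\uplus 1/(1+t)}$. **Theorem.** Let $\rho$ be a freely infinitely divisible state with free convolution semigroup $\{\rho_t\}$, let $\psi$ be a state, $\mathbf{a}\in\mathbb{R}^d$ and $t\ge 0$. (a)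 $\Phi[\rho^{\boxplus t}\boxplus\delta_{\mathbf{a}},\psi]=\Phi[\rho,\psi]^{\uplus t}\uplus\delta_{\mathbf{a}}$. (b) $\Phi[\rho,\psi\boxplus\rho_t]=\mathfrak{B}_t[\Phi[\rho,\psi]]$. Equivalently, if $R^{\phi,\psi}=R^\rho$, then $R^{\mathfrak{B}_t[\phi],\,\psi\boxplus\rho_t}=R^{\phi,\psi}=R^\rho$. More generally, $$\Phi[\rho,\psi\boxplus\rho^{\boxplus t}\boxplus\delta_{\mathbf{a}}]=\mathfrak{B}_{\mathbf{a},t}[\Phi[\rho,\psi]]=\mathfrak{B}_t[\Phi[\rho,\psi\boxplus\delta_{\mathbf{a}}]]=\mathfrak{B}_{\mathbf{a},0}[\Phi[\rho,\psi\boxplus\rho_t]].$$ Moreover, with $\rho_t$ replaced by $\rho^{\boxplus t}$, the same identities hold for arbitrary functionals $\rho,\psi$: (a) for all $t\in\mathbb{R}$, and (b) for all real $t\ne-1$. -/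

import Mathlib

open scoped ComplexOrder

noncomputable section

/-! ### Formal power series in non-commuting variables -/

/-- Formal power series over `ℂ` in the non-commuting variables `z_1, …, z_d`: a series assigns to
each word `u` in the letters `Fin d` the coefficient of `z_u`. -/
@[ext] structure NCSeries (d : ℕ) : Type where
  coeff : List (Fin d) → ℂ

namespace NCSeries

variable {d : ℕ}

instance : CoeFun (NCSeries d) fun _ => List (Fin d) → ℂ := ⟨coeff⟩

instance : Zero (NCSeries d) := ⟨⟨fun _ => 0⟩⟩

instance : Add (NCSeries d) := ⟨fun F G => ⟨fun w => F w + G w⟩⟩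

instance : Neg (NCSeries d) := ⟨fun F => ⟨fun w => -F w⟩⟩

instance : Sub (NCSeries d) := ⟨fun F G => ⟨fun w => F w - G w⟩⟩

instance {S : Type*} [SMul S ℂ] : SMul S (NCSeries d) := ⟨fun c F => ⟨fun w => c • F w⟩⟩

theorem coeff_injective : Function.Injective (coeff : NCSeries d → List (Fin d) → ℂ) :=
  fun _ _ h => NCSeries.ext h

instance : AddCommGroup (NCSeries d) :=
  coeff_injective.addCommGroup coeff rfl (fun _ _ => rfl) (fun _ => rfl) (fun _ _ => rfl)
    (fun _ _ => rfl) (fun _ _ => rfl)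

instance : Module ℂ (NCSeries d) :=
  coeff_injective.module ℂ ⟨⟨coeff, rfl⟩, fun _ _ => rfl⟩ (fun _ _ => rfl)

theorem ext' {F G : NCSeries d} (h : ∀ w, F w = G w) : F = G := NCSeries.ext (funext h)

theorem add_apply (F G : NCSeries d) (w : List (Fin d)) : (F + G) w = F w + G w := rfl

theorem sub_apply (F G : NCSeries d) (w : List (Fin d)) : (F - G) w = F w - G w := rfl

theorem zero_apply (w : List (Fin d)) : (0 : NCSeries d) w = 0 := rfl

theorem smul_apply (c : ℂ) (F : NCSeries d) (w : List (Fin d)) : (c • F) w = c * F w := rfl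

instance : One (NCSeries d) := ⟨⟨fun w => if w = [] then 1 else 0⟩⟩

/-- The product of series: words are multiplied by concatenation. -/
instance : Mul (NCSeries d) :=
  ⟨fun F G => ⟨fun w => ∑ k ∈ Finset.range (w.length + 1), F (w.take k) * G (w.drop k)⟩⟩

/-- The variable `z_i`. -/
def X (i : Fin d) : NCSeries d := ⟨fun w => if w = [i] then 1 else 0⟩

theorem one_apply (w : List (Fin d)) : (1 : NCSeries d) w = if w = [] then 1 else 0 := rfl

theorem mul_apply (F G : NCSeries d) (w : List (Fin d)) :
    (F * G) w = ∑ k ∈ Finset.range (w.length + 1), F (w.take k) * G (w.drop k) := rfl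

theorem mul_nil (F G : NCSeries d) : (F * G) [] = F [] * G [] := by
  simp [mul_apply]

/-- The left derivative `D_i`, which removes an initial letter `i`. -/
def leftD (i : Fin d) (F : NCSeries d) : NCSeries d := ⟨fun w => F (i :: w)⟩

theorem mul_cons (F G : NCSeries d) (i : Fin d) (w : List (Fin d)) :
    (F * G) (i :: w) = F [] * G (i :: w) + (leftD i F * G) w := by
  rw [mul_apply, mul_apply, List.length_cons, Finset.sum_range_succ']
  simp [leftD, add_comm]

protected theorem add_mul' (F G H : NCSeries d) : (F + G) * H = F * H + G * H := by
  refine ext' fun w => ?_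
  simp only [mul_apply, add_apply, add_mul, Finset.sum_add_distrib]

protected theorem mul_add' (F G H : NCSeries d) : F * (G + H) = F * G + F * H := by
  refine ext' fun w => ?_
  simp only [mul_apply, add_apply, mul_add, Finset.sum_add_distrib]

protected theorem smul_mul' (c : ℂ) (F G : NCSeries d) : (c • F) * G = c • (F * G) := by
  refine ext' fun w => ?_
  simp only [mul_apply, smul_apply, Finset.mul_sum, mul_assoc]

theorem leftD_mul (i : Fin d) (F G : NCSeries d) :
    leftD i (F * G) = F [] • leftD i G + leftD i F * G := by
  refine ext' fun w => ?_
  exact mul_cons F G i w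

protected theorem mul_assoc' (F G H : NCSeries d) : F * G * H = F * (G * H) := by
  refine ext' fun w => ?_
  induction w generalizing F G H with
  | nil => simp only [mul_nil, mul_assoc]
  | cons i w ih =>
    rw [mul_cons, mul_cons, mul_cons, mul_nil, leftD_mul, NCSeries.add_mul', add_apply,
      NCSeries.smul_mul', smul_apply, ih]
    ring

protected theorem one_mul' (F : NCSeries d) : 1 * F = F := by
  refine ext' fun w => ?_
  rw [mul_apply, Finset.sum_range_succ', Finset.sum_eq_zero]
  · simp [one_apply]
  · intro k hk
    rw [Finset.mem_range] at hk
    have : w ≠ [] := by rintro rfl; simp at hk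
    simp [one_apply, this]

protected theorem mul_one' (F : NCSeries d) : F * 1 = F := by
  refine ext' fun w => ?_
  rw [mul_apply, Finset.sum_range_succ, Finset.sum_eq_zero]
  · simp [one_apply]
  · intro k hk
    rw [Finset.mem_range] at hk
    simp [one_apply, hk]

instance : Ring (NCSeries d) :=
  { (inferInstance : AddCommGroup (NCSeries d)) with
    mul := (· * ·)
    one := 1
    left_distrib := NCSeries.mul_add'
    right_distrib := NCSeries.add_mul'
    zero_mul := fun F => by refine ext' fun w => ?_; simp [mul_apply, zero_apply]
    mul_zero := fun F => by refine ext' fun w => ?_; simp [mul_apply, zero_apply]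
    mul_assoc := NCSeries.mul_assoc'
    one_mul := NCSeries.one_mul'
    mul_one := NCSeries.mul_one' }

/-- The product `(G z_{u(1)}) (G z_{u(2)}) ⋯ (G z_{u(n)})`. -/
def wordProd (G : NCSeries d) (u : List (Fin d)) : NCSeries d := (u.map fun i => G * X i).prod

/-- The substitution `F(G z_1, …, G z_d) = ∑_u F_u (G z_{u(1)}) ⋯ (G z_{u(n)})`. Words `u` longer
than `w` do not contribute to the coefficient of `z_w`, so that the sum is finite. -/
def substMul (F G : NCSeries d) : NCSeries d :=
  ⟨fun w => ∑ k ∈ Finset.range (w.length + 1), ∑ u : Fin k → Fin d,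
    F (List.ofFn u) * wordProd G (List.ofFn u) w⟩

/-! Existence and uniqueness of the series that are defined implicitly below. -/

/-- A map for which the coefficients of degree `n` of the image depend only on the coefficients of
degree less than `n` has a unique fixed point. -/
theorem existsUnique_fixedPoint (T : NCSeries d → NCSeries d)
    (hT : ∀ (n : ℕ) (F G : NCSeries d), (∀ w, w.length < n → F w = G w) →
      ∀ w, w.length = n → T F w = T G w) :
    ∃! F, T F = F := by
  have key : ∀ (n m k : ℕ) (F G : NCSeries d), n ≤ m → n ≤ k →
      ∀ w, w.length < n → (T^[m] F) w = (T^[k] G) w := by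
    intro n
    induction n with
    | zero => intro m k F G _ _ w hw; omega
    | succ n ih =>
      intro m k F G hm hk w hw
      obtain ⟨m, rfl⟩ : ∃ m', m = m' + 1 := ⟨m - 1, by omega⟩
      obtain ⟨k, rfl⟩ : ∃ k', k = k' + 1 := ⟨k - 1, by omega⟩
      rw [Function.iterate_succ_apply', Function.iterate_succ_apply']
      exact hT w.length _ _
        (fun v hv => ih m k F G (by omega) (by omega) v (by omega)) w rfl
  refine ⟨⟨fun w => (T^[w.length + 1] 0) w⟩, ?_, ?_⟩
  · refine ext' fun w => ?_
    change _ = (T^[w.length + 1] 0) w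
    rw [Function.iterate_succ_apply']
    exact hT w.length _ _
      (fun v hv => key (v.length + 1) _ _ 0 0 le_rfl (by omega) v (by omega)) w rfl
  · intro F hF
    refine ext' fun w => ?_
    have h : T^[w.length + 1] F = F := Function.iterate_fixed hF _
    rw [← h]
    exact key (w.length + 1) _ _ F 0 le_rfl le_rfl w (by omega)

theorem isUnit_of_nil_eq_one {F : NCSeries d} (hF : F [] = 1) : IsUnit F := by
  have hN : (1 - F) [] = 0 := by rw [sub_apply, hF]; simp [one_apply]
  obtain ⟨L, hL, -⟩ := existsUnique_fixedPoint (fun G => 1 + G * (1 - F)) (by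
    intro n G H h w hw
    simp only [add_apply, mul_apply]
    congr 1
    refine Finset.sum_congr rfl fun k hk => ?_
    rw [Finset.mem_range] at hk
    by_cases hk' : k = w.length
    · simp [hk', hN]
    · rw [h (w.take k) (by rw [List.length_take]; omega)])
  obtain ⟨R, hR, -⟩ := existsUnique_fixedPoint (fun G => 1 + (1 - F) * G) (by
    intro n G H h w hw
    simp only [add_apply, mul_apply]
    congr 1
    refine Finset.sum_congr rfl fun k hk => ?_
    rw [Finset.mem_range] at hk
    by_cases hk' : k = 0
    · simp [hk', hN]
    · rw [h (w.drop k) (by rw [List.length_drop]; omega)])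
  have hL' : L * F = 1 := by
    have h : 1 + L * (1 - F) = L := hL
    rw [mul_sub, mul_one, ← add_sub_assoc, sub_eq_iff_eq_add, add_comm] at h
    exact (add_left_cancel h).symm
  have hR' : F * R = 1 := by
    have h : 1 + (1 - F) * R = R := hR
    rw [sub_mul, one_mul, ← add_sub_assoc, sub_eq_iff_eq_add, add_comm] at h
    exact (add_left_cancel h).symm
  exact ⟨⟨F, R, hR', by rw [← left_inv_eq_right_inv hL' hR', hL']⟩, rfl⟩

theorem mul_X_nil (G : NCSeries d) (i : Fin d) : (G * X i) [] = 0 := by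
  simp [mul_nil, X]

theorem mul_X_congr {n : ℕ} {G H : NCSeries d} (h : ∀ w, w.length < n → G w = H w) (i : Fin d)
    (w : List (Fin d)) (hw : w.length ≤ n) : (G * X i) w = (H * X i) w := by
  rw [mul_apply, mul_apply]
  refine Finset.sum_congr rfl fun k hk => ?_
  rw [Finset.mem_range] at hk
  by_cases hk' : k = w.length
  · simp [hk', X]
  · rw [h (w.take k) (by rw [List.length_take]; omega)]

theorem wordProd_cons (G : NCSeries d) (i : Fin d) (u : List (Fin d)) :
    wordProd G (i :: u) = G * X i * wordProd G u := by
  simp [wordProd]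

theorem wordProd_congr {n : ℕ} {G H : NCSeries d} (h : ∀ w, w.length < n → G w = H w)
    (u w : List (Fin d)) (hw : w.length ≤ n) : wordProd G u w = wordProd H u w := by
  induction u generalizing w with
  | nil => simp [wordProd]
  | cons i u ih =>
    rw [wordProd_cons, wordProd_cons, mul_apply, mul_apply]
    refine Finset.sum_congr rfl fun k hk => ?_
    rw [mul_X_congr h i _ (by rw [List.length_take]; omega),
      ih _ (by rw [List.length_drop]; omega)]

theorem wordProd_of_length_le {G : NCSeries d} (hG : G [] = 1) (u w : List (Fin d))
    (hw : w.length ≤ u.length) : wordProd G u w = if u = w then 1 else 0 := by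
  induction u generalizing w with
  | nil =>
    obtain rfl : w = [] := List.length_eq_zero_iff.1 (by simpa using hw)
    simp [wordProd, one_apply]
  | cons i u ih =>
    rw [wordProd_cons]
    cases w with
    | nil => simp [mul_nil, X]
    | cons j w =>
      rw [List.length_cons, List.length_cons] at hw
      rw [mul_cons, mul_X_nil, zero_mul, zero_add, mul_apply, Finset.sum_range_succ',
        Finset.sum_eq_zero]
      · have hj : leftD j (G * X i) [] = if i = j then 1 else 0 := by
          simp [leftD, mul_cons, mul_nil, X, hG, eq_comm]
        simp only [List.take_zero, List.drop_zero, hj, ih w (by omega), List.cons.injEq, zero_add]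
        by_cases h1 : i = j <;> by_cases h2 : u = w <;> simp [h1, h2]
      · intro k hk
        rw [Finset.mem_range] at hk
        rw [ih _ (by rw [List.length_drop]; omega), if_neg, mul_zero]
        rintro rfl
        rw [List.length_drop] at hw
        omega

theorem substMul_apply (F G : NCSeries d) (w : List (Fin d)) :
    substMul F G w = ∑ k ∈ Finset.range (w.length + 1), ∑ u : Fin k → Fin d,
      F (List.ofFn u) * wordProd G (List.ofFn u) w := rfl

theorem substMul_nil (F G : NCSeries d) : substMul F G [] = F [] := by
  simp [substMul, wordProd, one_apply]

theorem substMul_eq {G : NCSeries d} (hG : G [] = 1) (F : NCSeries d) (w : List (Fin d)) :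
    substMul F G w = (∑ k ∈ Finset.range w.length, ∑ u : Fin k → Fin d,
      F (List.ofFn u) * wordProd G (List.ofFn u) w) + F w := by
  rw [substMul_apply, Finset.sum_range_succ]
  congr 1
  rw [Finset.sum_eq_single (fun i => w.get i)]
  · rw [wordProd_of_length_le hG _ _ (by simp)]
    simp
  · intro u _ hu
    rw [wordProd_of_length_le hG _ _ (by simp), if_neg, mul_zero]
    intro h
    apply hu
    apply List.ofFn_injective
    rw [h]
    simp
  · simp

theorem existsUnique_substMul_eq {G : NCSeries d} (hG : G [] = 1) (S : NCSeries d) :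
    ∃! R, substMul R G = S := by
  have h := existsUnique_fixedPoint (fun R => S - (substMul R G - R)) (by
    intro n F H h w hw
    simp only [sub_apply, substMul_eq hG, add_sub_cancel_right]
    congr 1
    refine Finset.sum_congr rfl fun k hk => Finset.sum_congr rfl fun u _ => ?_
    rw [Finset.mem_range] at hk
    rw [h _ (by rw [List.length_ofFn]; omega)])
  refine (existsUnique_congr fun R => ?_).1 h
  constructor
  · intro h
    have h' : S - (substMul R G - R) = R := h
    rw [sub_eq_iff_eq_add, add_sub_cancel] at h'
    exact h'.symm
  · rintro rfl
    simp

theorem existsUnique_eq_substMul (R : NCSeries d) (hR : R [] = 0) :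
    ∃! M : NCSeries d, M [] = 0 ∧ M = substMul R (1 + M) := by
  have h := existsUnique_fixedPoint (fun M => substMul R (1 + M)) (by
    intro n F H h w hw
    rw [substMul_apply, substMul_apply]
    refine Finset.sum_congr rfl fun k hk => Finset.sum_congr rfl fun u _ => ?_
    rw [wordProd_congr (n := n) (fun v hv => ?_) _ _ hw.le]
    rw [add_apply, add_apply, h v hv])
  refine (existsUnique_congr fun M => ?_).1 h
  constructor
  · intro h
    have h' : substMul R (1 + M) = M := h
    exact ⟨by rw [← h', substMul_nil, hR], h'.symm⟩
  · exact fun h => h.2.symm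

end NCSeries

/-! ### Functionals on non-commutative polynomials -/

/-- The monomial `x_u = x_{u(1)} ⋯ x_{u(n)}` in `ℂ⟨x_1, …, x_d⟩`. -/
def ncMonomial {d : ℕ} (u : List (Fin d)) : FreeAlgebra ℂ (Fin d) :=
  (u.map (FreeAlgebra.ι ℂ)).prod

/-- The involution of the `*`-algebra `ℂ⟨x_1, …, x_d⟩`: it is conjugate linear, reverses products
and fixes the variables. (The instance `star` of `FreeAlgebra` is linear instead.) -/
def ncAdjoint {d : ℕ} (P : FreeAlgebra ℂ (Fin d)) : FreeAlgebra ℂ (Fin d) :=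
  ((FreeAlgebra.basisFreeMonoid ℂ (Fin d)).repr P).sum fun u c =>
    starRingEnd ℂ c • ncMonomial u.toList.reverse

/-- Unital linear functionals on `ℂ⟨x_1, …, x_d⟩`. -/
structure NCFunctional (d : ℕ) where
  toLin : FreeAlgebra ℂ (Fin d) →ₗ[ℂ] ℂ
  map_one : toLin 1 = 1

namespace NCFunctional

open NCSeries

variable {d : ℕ}

/-- States: `*`-compatible, positive definite functionals. -/
def IsState (φ : NCFunctional d) : Prop :=
  (∀ P, φ.toLin (ncAdjoint P) = starRingEnd ℂ (φ.toLin P)) ∧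
    ∀ P, 0 ≤ φ.toLin (ncAdjoint P * P)

/-- The functional `δ_a`, evaluation at the point `a`. -/
def delta (a : Fin d → ℝ) : NCFunctional d where
  toLin := (FreeAlgebra.lift ℂ fun i => (a i : ℂ)).toLinearMap
  map_one := by simp

/-- The moment generating function `M^φ`, without constant term. -/
def momentSeries (φ : NCFunctional d) : NCSeries d :=
  ⟨fun u => if u = [] then 0 else φ.toLin (ncMonomial u)⟩

theorem momentSeries_nil (φ : NCFunctional d) : φ.momentSeries [] = 0 := by
  simp [momentSeries]

theorem one_add_momentSeries_nil (φ : NCFunctional d) : (1 + φ.momentSeries) [] = 1 := by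
  simp [add_apply, one_apply, momentSeries_nil]

theorem basisFreeMonoid_apply (u : List (Fin d)) :
    FreeAlgebra.basisFreeMonoid ℂ (Fin d) (FreeMonoid.ofList u) = ncMonomial u := by
  have h : (FreeMonoid.lift (FreeAlgebra.ι ℂ (X := Fin d))) (FreeMonoid.ofList u) =
      ncMonomial u := by
    simp [FreeMonoid.lift_apply, ncMonomial]
  simp [FreeAlgebra.basisFreeMonoid, FreeAlgebra.equivMonoidAlgebraFreeMonoid, h]

theorem existsUnique_momentSeries_eq (M : NCSeries d) (hM : M [] = 0) :
    ∃! φ : NCFunctional d, φ.momentSeries = M := by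
  let b := FreeAlgebra.basisFreeMonoid ℂ (Fin d)
  refine ⟨⟨b.constr ℂ fun u => (1 + M) u.toList, ?_⟩, ?_, ?_⟩
  · have h : (1 : FreeAlgebra ℂ (Fin d)) = b (FreeMonoid.ofList []) := by
      rw [basisFreeMonoid_apply]; simp [ncMonomial]
    rw [h, Module.Basis.constr_basis]
    simp [add_apply, one_apply, hM]
  · refine ext' fun w => ?_
    by_cases hw : w = []
    · simp [momentSeries, hw, hM]
    · have h : ncMonomial w = b (FreeMonoid.ofList w) := (basisFreeMonoid_apply w).symm
      simp only [momentSeries, hw, if_false, h, Module.Basis.constr_basis]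
      simp [add_apply, one_apply, hw]
  · intro φ hφ
    have h : φ.toLin = b.constr ℂ fun u => (1 + M) u.toList := by
      refine b.ext fun u => ?_
      rw [Module.Basis.constr_basis]
      have hu : b u = ncMonomial u.toList := basisFreeMonoid_apply u.toList
      rw [hu, ← hφ]
      by_cases hw : u.toList = []
      · rw [hw]; simp [add_apply, one_apply, momentSeries, ncMonomial, φ.map_one]
      · simp [add_apply, one_apply, momentSeries, hw]
    cases φ
    simp only at h
    subst h
    rfl

/-- The Boolean cumulant generating function `η^φ = 1 - (1 + M^φ)⁻¹`. -/
def boolCumulant (φ : NCFunctional d) : NCSeries d := 1 - Ring.inverse (1 + φ.momentSeries)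

theorem boolCumulant_nil (φ : NCFunctional d) : φ.boolCumulant [] = 0 := by
  have h := congrArg (fun F : NCSeries d => F []) (Ring.mul_inverse_cancel _
    (isUnit_of_nil_eq_one φ.one_add_momentSeries_nil))
  simp only [mul_nil, one_add_momentSeries_nil, one_mul] at h
  rw [boolCumulant, sub_apply, h, sub_self]

theorem existsUnique_boolCumulant_eq (E : NCSeries d) (hE : E [] = 0) :
    ∃! φ : NCFunctional d, φ.boolCumulant = E := by
  have hE' : (1 - E) [] = 1 := by simp [sub_apply, one_apply, hE]
  have hu := isUnit_of_nil_eq_one hE'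
  have key : ∀ φ : NCFunctional d,
      φ.momentSeries = Ring.inverse (1 - E) - 1 ↔ φ.boolCumulant = E := by
    intro φ
    have hv := isUnit_of_nil_eq_one φ.one_add_momentSeries_nil
    rw [boolCumulant, eq_sub_iff_add_eq', sub_eq_iff_eq_add, ← sub_eq_iff_eq_add']
    constructor
    · intro h
      rw [h, Ring.inverse_inverse hu]
    · intro h
      rw [h, Ring.inverse_inverse hv]
  refine (existsUnique_congr key).1 (existsUnique_momentSeries_eq _ ?_)
  have h := congrArg (fun F : NCSeries d => F []) (Ring.mul_inverse_cancel _ hu)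
  simp only [mul_nil, hE', one_mul] at h
  rw [NCSeries.sub_apply, h, sub_self]

/-- The free cumulant generating function `R^ψ`, the unique series with
`M^ψ(w) = R^ψ((1 + M^ψ(w)) w)`. -/
def freeCumulant (ψ : NCFunctional d) : NCSeries d :=
  (existsUnique_substMul_eq ψ.one_add_momentSeries_nil ψ.momentSeries).choose

theorem substMul_freeCumulant (ψ : NCFunctional d) :
    substMul ψ.freeCumulant (1 + ψ.momentSeries) = ψ.momentSeries :=
  (existsUnique_substMul_eq ψ.one_add_momentSeries_nil ψ.momentSeries).choose_spec.1

theorem freeCumulant_nil (ψ : NCFunctional d) : ψ.freeCumulant [] = 0 := by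
  rw [← substMul_nil ψ.freeCumulant (1 + ψ.momentSeries), substMul_freeCumulant, momentSeries_nil]

theorem existsUnique_freeCumulant_eq (R : NCSeries d) (hR : R [] = 0) :
    ∃! ψ : NCFunctional d, ψ.freeCumulant = R := by
  have key : ∀ ψ : NCFunctional d,
      ψ.freeCumulant = R ↔ ψ.momentSeries = substMul R (1 + ψ.momentSeries) := by
    intro ψ
    constructor
    · rintro rfl
      exact ψ.substMul_freeCumulant.symm
    · intro h
      exact (existsUnique_substMul_eq ψ.one_add_momentSeries_nil ψ.momentSeries).unique
        ψ.substMul_freeCumulant h.symm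
  obtain ⟨M, ⟨hM0, hM⟩, hM'⟩ := existsUnique_eq_substMul R hR
  refine (existsUnique_congr fun ψ => ?_).1 (existsUnique_momentSeries_eq M hM0)
  rw [key]
  constructor
  · rintro rfl
    exact hM
  · intro h
    exact hM' _ ⟨ψ.momentSeries_nil, h⟩

theorem existsUnique_condFreeCumulant (φ ψ : NCFunctional d) :
    ∃! R : NCSeries d, φ.boolCumulant =
      Ring.inverse (1 + ψ.momentSeries) * substMul R (1 + ψ.momentSeries) := by
  have hu := isUnit_of_nil_eq_one ψ.one_add_momentSeries_nil
  refine (existsUnique_congr fun R => ?_).1 (existsUnique_substMul_eq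
    ψ.one_add_momentSeries_nil ((1 + ψ.momentSeries) * φ.boolCumulant))
  constructor
  · intro h
    rw [h, ← mul_assoc, Ring.inverse_mul_cancel _ hu, one_mul]
  · intro h
    rw [h, ← mul_assoc, Ring.mul_inverse_cancel _ hu, one_mul]

/-- The conditionally free cumulant generating function `R^{φ,ψ}`, the unique series with
`η^φ(w) = (1 + M^ψ(w))⁻¹ R^{φ,ψ}((1 + M^ψ(w)) w)`. -/
def condFreeCumulant (φ ψ : NCFunctional d) : NCSeries d :=
  (existsUnique_condFreeCumulant φ ψ).choose

/-! ### Convolutions and the transformations -/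

/-- The free convolution `φ ⊞ ψ`, the functional with `R^{φ ⊞ ψ} = R^φ + R^ψ`. -/
def freeConv (φ ψ : NCFunctional d) : NCFunctional d :=
  (existsUnique_freeCumulant_eq (φ.freeCumulant + ψ.freeCumulant)
    (by rw [add_apply, freeCumulant_nil, freeCumulant_nil, add_zero])).choose

/-- The free convolution power `φ^{⊞ t}`, the functional with free cumulants `t R^φ`. -/
def freePow (φ : NCFunctional d) (t : ℝ) : NCFunctional d :=
  (existsUnique_freeCumulant_eq ((t : ℂ) • φ.freeCumulant)
    (by rw [smul_apply, freeCumulant_nil, mul_zero])).choose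

/-- The Boolean convolution `φ ⊎ ψ`, the functional with `η^{φ ⊎ ψ} = η^φ + η^ψ`. -/
def boolConv (φ ψ : NCFunctional d) : NCFunctional d :=
  (existsUnique_boolCumulant_eq (φ.boolCumulant + ψ.boolCumulant)
    (by rw [add_apply, boolCumulant_nil, boolCumulant_nil, add_zero])).choose

/-- The Boolean convolution power `φ^{⊎ t}`, the functional with Boolean cumulants `t η^φ`. -/
def boolPow (φ : NCFunctional d) (t : ℝ) : NCFunctional d :=
  (existsUnique_boolCumulant_eq ((t : ℂ) • φ.boolCumulant)
    (by rw [smul_apply, boolCumulant_nil, mul_zero])).choose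

/-- `ρ` is a freely infinitely divisible state: `ρ^{⊞ t}` is a state for all `t ≥ 0`. -/
def IsFreelyInfinitelyDivisible (ρ : NCFunctional d) : Prop :=
  ∀ t : ℝ, 0 ≤ t → (ρ.freePow t).IsState

/-- The functional `Φ[ρ, ψ]`, whose Boolean cumulant generating function is
`(1 + M^ψ(w))⁻¹ R^ρ((1 + M^ψ(w)) w)`. -/
def Phi (ρ ψ : NCFunctional d) : NCFunctional d :=
  (existsUnique_boolCumulant_eq
    (Ring.inverse (1 + ψ.momentSeries) * substMul ρ.freeCumulant (1 + ψ.momentSeries))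
    (by rw [mul_nil, substMul_nil, freeCumulant_nil, mul_zero])).choose

/-- The transformation
`𝔹_{a,t}[φ] = ((φ^{⊞ (1+t)} ⊞ δ_a) ⊎ δ_{-a})^{⊎ 1/(1+t)}`, for `t ≠ -1`. -/
def BTwo (a : Fin d → ℝ) (t : ℝ) (φ : NCFunctional d) : NCFunctional d :=
  (((φ.freePow (1 + t)).freeConv (delta a)).boolConv (delta (-a))).boolPow (1 / (1 + t))

/-- The Belinschi-Nica transformation `𝔹_t[φ] = (φ^{⊞ (1+t)})^{⊎ 1/(1+t)}`, for `t ≠ -1`. -/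
def BOne (t : ℝ) (φ : NCFunctional d) : NCFunctional d :=
  (φ.freePow (1 + t)).boolPow (1 / (1 + t))

end NCFunctional

end

/-! ### Calculus of the substitution `F(G w)`. -/

namespace NCSeries

variable {d : ℕ}

/-! Put G = 1 + M^ψ and L = ∑ a_i z_i. Then η = η^Φ[ρ,ψ] is characterised by G η = R^ρ(G w), which
is linear in R^ρ; since L is both the free and the Boolean cumulant series of δ_a, and L(G w) = G L,
part (a) follows.

Part (b) is a subordination argument. Let G' = 1 + M^ψ' for ψ' = ψ ⊞ ρ^{⊞t} ⊞ δ_a and Q = R^ρ(G' w),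
so that G' = A + tQ + G'L with A = 1 + R^ψ(G' w). Choose H with A H = G'. By uniqueness of the
solution of K = 1 + R^ψ(K H w), A = G(H w). Let φ = Φ[ρ,ψ], e = η^φ(H w) and f = (1 + M^φ)(H w), so
f(1 - e) = 1. Substituting H w for w in G η^φ = R^ρ(G w) gives A e = Q, hence H - HL = 1 + te.
Multiplying by f turns this into the fixed-point equation of σ = φ^{⊞(1+t)} ⊞ δ_a, so 1 + M^σ = f H.
Comparing inverses, G' η^σ = (1+t)Q + G'L; removing L and dividing by 1+t leaves the equation of
Φ[ρ,ψ'].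

The argument rests on substitution being multiplicative (`substMul_mul`) and on its composition law
(`substMul_substMul`). -/

protected theorem mul_smul' (c : ℂ) (F G : NCSeries d) : F * (c • G) = c • (F * G) := by
  refine ext' fun w => ?_
  simp only [mul_apply, smul_apply, Finset.mul_sum, mul_left_comm]

theorem sum_apply {ι : Type*} (s : Finset ι) (F : ι → NCSeries d) (w : List (Fin d)) :
    (∑ i ∈ s, F i) w = ∑ i ∈ s, F i w := by
  classical
  induction s using Finset.induction_on with
  | empty => simp [zero_apply]
  | insert i s hi ih => rw [Finset.sum_insert hi, Finset.sum_insert hi, add_apply, ih]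

/-- Left multiplication by a series without constant term raises the order. -/
theorem mul_apply_congr {P A B : NCSeries d} (hP : P [] = 0) (w : List (Fin d))
    (h : ∀ v : List (Fin d), v.length < w.length → A v = B v) : (P * A) w = (P * B) w := by
  rw [mul_apply, mul_apply]
  refine Finset.sum_congr rfl fun k hk => ?_
  rw [Finset.mem_range] at hk
  by_cases hk' : k = 0
  · simp [hk', hP]
  · by_cases hw : w = []
    · subst hw; simp_all
    · rw [h (w.drop k) (by rw [List.length_drop]; have := List.length_pos_iff.2 hw; omega)]

theorem wordProd_eq_zero (G : NCSeries d) (u w : List (Fin d)) (h : w.length < u.length) :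
    wordProd G u w = 0 := by
  induction u generalizing w with
  | nil => simp at h
  | cons i u ih =>
    rw [wordProd_cons, mul_apply_congr (B := 0) (mul_X_nil G i) w, mul_zero, zero_apply]
    intro v hv
    rw [List.length_cons] at h
    rw [ih v (by omega), zero_apply]

/-- A cutoff independent of `w` lets one finite sum represent the substitution on all short words
simultaneously. -/
theorem substMul_apply_of_lt (F G : NCSeries d) (w : List (Fin d)) {n : ℕ} (hn : w.length < n) :
    substMul F G w = ∑ k ∈ Finset.range n, ∑ u : Fin k → Fin d,
      F (List.ofFn u) * wordProd G (List.ofFn u) w := by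
  rw [substMul_apply]
  refine Finset.sum_subset (Finset.range_mono hn) fun k _ hk => ?_
  refine Finset.sum_eq_zero fun u _ => ?_
  rw [Finset.mem_range] at hk
  rw [wordProd_eq_zero _ _ _ (by rw [List.length_ofFn]; omega), mul_zero]

/-- Splitting off the first letter of each substituted word gives a recursion. Each `G * X i` has no
constant term, so the recursion supports induction on word length in place of manipulating multiple
sums. -/
theorem substMul_eq_sum_leftD (F G : NCSeries d) :
    substMul F G = F [] • 1 + ∑ i, G * X i * substMul (leftD i F) G := by
  refine ext' fun w => ?_
  have hT : ∀ i, (G * X i * substMul (leftD i F) G) w =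
      ∑ k ∈ Finset.range w.length, ∑ u : Fin k → Fin d,
        F (i :: List.ofFn u) * wordProd G (i :: List.ofFn u) w := by
    intro i
    have h : (G * X i * substMul (leftD i F) G) w =
        (G * X i * ∑ k ∈ Finset.range w.length, ∑ u : Fin k → Fin d,
          F (i :: List.ofFn u) • wordProd G (List.ofFn u)) w := by
      refine mul_apply_congr (mul_X_nil G i) w fun v hv => ?_
      rw [substMul_apply_of_lt _ _ _ hv]
      simp only [sum_apply, smul_apply]
      rfl
    rw [h]
    simp only [Finset.mul_sum, sum_apply, NCSeries.mul_smul', smul_apply, wordProd_cons]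
  rw [add_apply, sum_apply, substMul_apply, Finset.sum_range_succ', add_comm]
  congr 1
  · simp [wordProd, smul_apply]
  · simp only [hT]
    rw [Finset.sum_comm]
    refine Finset.sum_congr rfl fun k _ => ?_
    -- A word of length `k + 1` is a first letter together with a word of length `k`.
    rw [← (Fin.consEquiv fun _ : Fin (k + 1) => Fin d).sum_comp, Fintype.sum_prod_type]
    simp [Fin.consEquiv, List.ofFn_succ]

theorem substMul_add (F F' G : NCSeries d) :
    substMul (F + F') G = substMul F G + substMul F' G := by
  refine ext' fun w => ?_
  simp only [substMul_apply, add_apply, add_mul, Finset.sum_add_distrib]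

theorem substMul_smul (c : ℂ) (F G : NCSeries d) : substMul (c • F) G = c • substMul F G := by
  refine ext' fun w => ?_
  simp only [substMul_apply, smul_apply, Finset.mul_sum, mul_assoc]

theorem substMul_zero (G : NCSeries d) : substMul 0 G = 0 := by
  refine ext' fun w => ?_
  simp [substMul_apply, zero_apply]

theorem substMul_sub (F F' G : NCSeries d) :
    substMul (F - F') G = substMul F G - substMul F' G := by
  rw [eq_sub_iff_add_eq, ← substMul_add, sub_add_cancel]

theorem leftD_one (i : Fin d) : leftD i (1 : NCSeries d) = 0 := by
  refine ext' fun w => ?_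
  simp [leftD, one_apply, zero_apply]

theorem leftD_X (i j : Fin d) : leftD i (X j) = if i = j then 1 else 0 := by
  refine ext' fun w => ?_
  split_ifs with h <;> simp [leftD, X, one_apply, zero_apply, h]

theorem substMul_one (G : NCSeries d) : substMul 1 G = 1 := by
  rw [substMul_eq_sum_leftD]
  simp [leftD_one, substMul_zero, one_apply]

theorem substMul_X (G : NCSeries d) (j : Fin d) : substMul (X j) G = G * X j := by
  rw [substMul_eq_sum_leftD, Finset.sum_eq_single j]
  · have h : X j [] = 0 := by simp [X]
    rw [leftD_X, if_pos rfl, substMul_one, mul_one, h, zero_smul, zero_add]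
  · intro i _ hi
    simp [leftD_X, hi, substMul_zero]
  · simp

theorem substMul_sum {ι : Type*} (s : Finset ι) (F : ι → NCSeries d) (G : NCSeries d) :
    substMul (∑ i ∈ s, F i) G = ∑ i ∈ s, substMul (F i) G := by
  classical
  induction s using Finset.induction_on with
  | empty => simp [substMul_zero]
  | insert i s hi ih => rw [Finset.sum_insert hi, Finset.sum_insert hi, substMul_add, ih]

/-- By the Leibniz rule `leftD_mul`, both sides obey the same first-letter recursion. The induction
must generalise `F`, which is replaced by its left derivatives. -/
theorem substMul_mul (F F' G : NCSeries d) :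
    substMul (F * F') G = substMul F G * substMul F' G := by
  refine ext' fun w => ?_
  induction h : w.length using Nat.strong_induction_on generalizing w F with
  | _ n ih =>
    have h1 : substMul (F * F') G =
        F [] • substMul F' G + ∑ i, G * X i * substMul (leftD i F * F') G := by
      rw [substMul_eq_sum_leftD (F * F'), substMul_eq_sum_leftD F', mul_nil, smul_add, smul_smul,
        Finset.smul_sum, add_assoc, ← Finset.sum_add_distrib]
      simp only [leftD_mul, substMul_add, substMul_smul, mul_add, NCSeries.mul_smul']
    have h2 : substMul F G * substMul F' G =
        F [] • substMul F' G + ∑ i, G * X i * (substMul (leftD i F) G * substMul F' G) := by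
      rw [substMul_eq_sum_leftD F, add_mul, NCSeries.smul_mul', one_mul, Finset.sum_mul]
      simp only [mul_assoc]
    rw [h1, h2, add_apply, add_apply, sum_apply, sum_apply]
    congr 1
    refine Finset.sum_congr rfl fun i _ => ?_
    exact mul_apply_congr (mul_X_nil G i) w fun v hv => ih v.length (h ▸ hv) _ v rfl

/-- Substituting `w_i ↦ H w_i` into `F(G w)` gives `F(G(H w) H w)`. -/
theorem substMul_substMul (F G H : NCSeries d) :
    substMul (substMul F G) H = substMul F (substMul G H * H) := by
  refine ext' fun w => ?_
  induction h : w.length using Nat.strong_induction_on generalizing w F with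
  | _ n ih =>
    -- Multiplicativity turns each factor `G * X i` into `substMul G H * H * X i`, which is the
    -- factor in the recursion for the right-hand side.
    have h1 : substMul (substMul F G) H =
        F [] • 1 + ∑ i, substMul G H * H * X i * substMul (substMul (leftD i F) G) H := by
      conv_lhs => rw [substMul_eq_sum_leftD F G]
      simp only [substMul_add, substMul_smul, substMul_one, substMul_sum, substMul_mul,
        substMul_X, mul_assoc]
    rw [h1, substMul_eq_sum_leftD F, add_apply, add_apply, sum_apply, sum_apply]
    congr 1
    refine Finset.sum_congr rfl fun i _ => ?_
    exact mul_apply_congr (mul_X_nil _ i) w fun v hv => ih v.length (h ▸ hv) _ v rfl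

/-- The equation `K = 1 + R(K H w)` has at most one solution `K`. -/
theorem eq_of_eq_one_add_substMul {R H K K' : NCSeries d} (hK : K = 1 + substMul R (K * H))
    (hK' : K' = 1 + substMul R (K' * H)) : K = K' := by
  refine (existsUnique_fixedPoint (fun K => 1 + substMul R (K * H)) ?_).unique hK.symm hK'.symm
  intro n F G h w hw
  rw [add_apply, add_apply, substMul_apply, substMul_apply]
  congr 1
  refine Finset.sum_congr rfl fun k hk => Finset.sum_congr rfl fun u _ => ?_
  -- Every factor of `wordProd` carries a letter, so degree `n` only involves coefficients of `K *
  -- H` of lower degree.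
  rw [wordProd_congr (n := n) (fun v hv => ?_) _ _ hw.le]
  rw [mul_apply, mul_apply]
  refine Finset.sum_congr rfl fun j _ => ?_
  rw [h (v.take j) (by rw [List.length_take]; omega)]

end NCSeries

/-! ### Functionals characterised by their cumulant series. -/

namespace NCFunctional

open NCSeries

variable {d : ℕ}

theorem isUnit_one_add_momentSeries (φ : NCFunctional d) : IsUnit (1 + φ.momentSeries) :=
  isUnit_of_nil_eq_one φ.one_add_momentSeries_nil

theorem ext_boolCumulant {φ ψ : NCFunctional d} (h : φ.boolCumulant = ψ.boolCumulant) : φ = ψ :=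
  (existsUnique_boolCumulant_eq ψ.boolCumulant ψ.boolCumulant_nil).unique h rfl

theorem ext_freeCumulant {φ ψ : NCFunctional d} (h : φ.freeCumulant = ψ.freeCumulant) : φ = ψ :=
  (existsUnique_freeCumulant_eq ψ.freeCumulant ψ.freeCumulant_nil).unique h rfl

theorem one_add_momentSeries_mul (φ : NCFunctional d) :
    (1 + φ.momentSeries) * (1 - φ.boolCumulant) = 1 := by
  rw [boolCumulant, sub_sub_cancel, Ring.mul_inverse_cancel _ φ.isUnit_one_add_momentSeries]

theorem freeCumulant_eq_of_substMul {ψ : NCFunctional d} {R : NCSeries d}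
    (h : substMul R (1 + ψ.momentSeries) = ψ.momentSeries) : ψ.freeCumulant = R :=
  (existsUnique_substMul_eq ψ.one_add_momentSeries_nil ψ.momentSeries).unique
    ψ.substMul_freeCumulant h

/-- Recognises a moment series as a solution of the fixed-point equation; used for the series `f * H
- 1` in the main computation. -/
theorem momentSeries_eq_of_substMul {ψ : NCFunctional d} {M : NCSeries d} (hM : M [] = 0)
    (h : M = substMul ψ.freeCumulant (1 + M)) : ψ.momentSeries = M :=
  (existsUnique_eq_substMul ψ.freeCumulant ψ.freeCumulant_nil).unique
    ⟨ψ.momentSeries_nil, ψ.substMul_freeCumulant.symm⟩ ⟨hM, h⟩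

theorem freeCumulant_freeConv (φ ψ : NCFunctional d) :
    (φ.freeConv ψ).freeCumulant = φ.freeCumulant + ψ.freeCumulant := by
  rw [freeConv]
  generalize_proofs h
  exact h.choose_spec.1

theorem freeCumulant_freePow (φ : NCFunctional d) (t : ℝ) :
    (φ.freePow t).freeCumulant = (t : ℂ) • φ.freeCumulant := by
  rw [freePow]
  generalize_proofs h
  exact h.choose_spec.1

theorem boolCumulant_boolConv (φ ψ : NCFunctional d) :
    (φ.boolConv ψ).boolCumulant = φ.boolCumulant + ψ.boolCumulant := by
  rw [boolConv]
  generalize_proofs h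
  exact h.choose_spec.1

theorem boolCumulant_boolPow (φ : NCFunctional d) (t : ℝ) :
    (φ.boolPow t).boolCumulant = (t : ℂ) • φ.boolCumulant := by
  rw [boolPow]
  generalize_proofs h
  exact h.choose_spec.1

theorem boolCumulant_Phi (ρ ψ : NCFunctional d) :
    (ρ.Phi ψ).boolCumulant =
      Ring.inverse (1 + ψ.momentSeries) * substMul ρ.freeCumulant (1 + ψ.momentSeries) := by
  rw [Phi]
  generalize_proofs h
  exact h.choose_spec.1

theorem boolCumulant_eq_condFreeCumulant (φ ψ : NCFunctional d) :
    φ.boolCumulant =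
      Ring.inverse (1 + ψ.momentSeries) * substMul (φ.condFreeCumulant ψ) (1 + ψ.momentSeries) :=
  (existsUnique_condFreeCumulant φ ψ).choose_spec.1

theorem one_add_momentSeries_mul_boolCumulant_Phi (ρ ψ : NCFunctional d) :
    (1 + ψ.momentSeries) * (ρ.Phi ψ).boolCumulant =
      substMul ρ.freeCumulant (1 + ψ.momentSeries) := by
  rw [boolCumulant_Phi, ← mul_assoc, Ring.mul_inverse_cancel _ ψ.isUnit_one_add_momentSeries,
    one_mul]

/-- Inverse-free criterion, obtained by cancelling the unit `1 + ψ.momentSeries` on the left. -/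
theorem eq_Phi_of_mul_boolCumulant {φ ρ ψ : NCFunctional d}
    (h : (1 + ψ.momentSeries) * φ.boolCumulant = substMul ρ.freeCumulant (1 + ψ.momentSeries)) :
    φ = ρ.Phi ψ :=
  ext_boolCumulant (ψ.isUnit_one_add_momentSeries.mul_left_cancel
    (h.trans (one_add_momentSeries_mul_boolCumulant_Phi ρ ψ).symm))

theorem condFreeCumulant_eq_iff {φ ρ ψ : NCFunctional d} :
    φ.condFreeCumulant ψ = ρ.freeCumulant ↔ φ = ρ.Phi ψ := by
  constructor
  · intro h
    apply ext_boolCumulant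
    rw [boolCumulant_Phi, boolCumulant_eq_condFreeCumulant φ ψ, h]
  · rintro rfl
    exact (existsUnique_condFreeCumulant _ ψ).unique (boolCumulant_eq_condFreeCumulant _ ψ)
      (boolCumulant_Phi ρ ψ)

/-! ### Point masses -/

/-- The linear series `∑ a_i z_i`. -/
def linearSeries (a : Fin d → ℝ) : NCSeries d := ∑ i, (a i : ℂ) • X i

theorem substMul_linearSeries (a : Fin d → ℝ) (G : NCSeries d) :
    substMul (linearSeries a) G = G * linearSeries a := by
  simp only [linearSeries, substMul_sum, substMul_smul, substMul_X, Finset.mul_sum,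
    NCSeries.mul_smul']

theorem linearSeries_nil (a : Fin d → ℝ) : linearSeries a [] = 0 := by
  simp only [linearSeries, sum_apply, smul_apply]
  simp [X]

theorem leftD_linearSeries (a : Fin d → ℝ) (i : Fin d) :
    leftD i (linearSeries a) = (a i : ℂ) • 1 := by
  refine ext' fun w => ?_
  change linearSeries a (i :: w) = _
  simp only [linearSeries, sum_apply, smul_apply]
  simp [X, one_apply, ite_and]

theorem linearSeries_neg (a : Fin d → ℝ) : linearSeries (-a) = -linearSeries a := by
  simp [linearSeries]

theorem linearSeries_zero : linearSeries (0 : Fin d → ℝ) = 0 := by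
  simp [linearSeries]

theorem one_add_momentSeries_delta_apply (a : Fin d → ℝ) (u : List (Fin d)) :
    (1 + (delta a).momentSeries) u = (u.map fun i => (a i : ℂ)).prod := by
  cases u with
  | nil => simp [one_add_momentSeries_nil]
  | cons i u =>
    simp [add_apply, one_apply, momentSeries, delta, ncMonomial, map_list_prod, Function.comp_def]

/-- The moments are multiplicative along words, so removing a first letter `i` costs a factor `a i`:
the moment series is geometric in `linearSeries a`. -/
theorem one_add_momentSeries_delta_mul (a : Fin d → ℝ) :
    (1 - linearSeries a) * (1 + (delta a).momentSeries) = 1 := by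
  have h : linearSeries a * (1 + (delta a).momentSeries) = (delta a).momentSeries := by
    refine ext' fun u => ?_
    cases u with
    | nil => rw [mul_nil, linearSeries_nil, zero_mul, momentSeries_nil]
    | cons i u =>
      have h' : (delta a).momentSeries (i :: u) = (1 + (delta a).momentSeries) (i :: u) := by
        simp [add_apply, one_apply]
      rw [mul_cons, linearSeries_nil, zero_mul, zero_add, leftD_linearSeries,
        NCSeries.smul_mul', one_mul, smul_apply, h', one_add_momentSeries_delta_apply,
        one_add_momentSeries_delta_apply, List.map_cons, List.prod_cons]
  rw [sub_mul, one_mul, h, add_sub_cancel_right]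

theorem boolCumulant_delta (a : Fin d → ℝ) : (delta a).boolCumulant = linearSeries a := by
  have h : 1 - linearSeries a = 1 - (delta a).boolCumulant :=
    left_inv_eq_right_inv (one_add_momentSeries_delta_mul a) (one_add_momentSeries_mul _)
  exact (sub_right_injective h).symm

/-- With G = 1 + M and L linear, G(1 - L) = 1 reads M = G L = L(G w), the defining equation of the
free cumulants. -/
theorem freeCumulant_delta (a : Fin d → ℝ) : (delta a).freeCumulant = linearSeries a := by
  apply freeCumulant_eq_of_substMul
  have h := (delta a).one_add_momentSeries_mul
  rw [boolCumulant_delta, mul_sub, mul_one, sub_eq_iff_eq_add, add_comm] at h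
  rw [substMul_linearSeries]
  rw [add_comm] at h
  exact (add_left_cancel h).symm

theorem BTwo_zero (φ : NCFunctional d) (t : ℝ) : φ.BTwo 0 t = φ.BOne t := by
  have h1 : (φ.freePow (1 + t)).freeConv (delta 0) = φ.freePow (1 + t) := by
    apply ext_freeCumulant
    rw [freeCumulant_freeConv, freeCumulant_delta, linearSeries_zero, add_zero]
  have h2 : (φ.freePow (1 + t)).boolConv (delta (-0)) = φ.freePow (1 + t) := by
    apply ext_boolCumulant
    rw [boolCumulant_boolConv, boolCumulant_delta, neg_zero, linearSeries_zero, add_zero]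
  rw [BTwo, BOne, h1, h2]

/-! ### Evolution equations -/

theorem Phi_freeConv_delta (ρ ψ : NCFunctional d) (a : Fin d → ℝ) (t : ℝ) :
    ((ρ.freePow t).freeConv (delta a)).Phi ψ = ((ρ.Phi ψ).boolPow t).boolConv (delta a) := by
  symm
  apply eq_Phi_of_mul_boolCumulant
  rw [boolCumulant_boolConv, boolCumulant_boolPow, boolCumulant_delta, freeCumulant_freeConv,
    freeCumulant_freePow, freeCumulant_delta, substMul_add, substMul_smul, substMul_linearSeries,
    mul_add, NCSeries.mul_smul', one_add_momentSeries_mul_boolCumulant_Phi]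

theorem Phi_freeConv_freePow_delta (ρ ψ : NCFunctional d) (a : Fin d → ℝ) {t : ℝ} (ht : t ≠ -1) :
    ρ.Phi ((ψ.freeConv (ρ.freePow t)).freeConv (delta a)) = (ρ.Phi ψ).BTwo a t := by
  symm
  apply eq_Phi_of_mul_boolCumulant
  set ψ' := (ψ.freeConv (ρ.freePow t)).freeConv (delta a) with hψ'
  set φ := ρ.Phi ψ
  set L := linearSeries a with hL
  set G' := 1 + ψ'.momentSeries with hG'
  set G := 1 + ψ.momentSeries with hG
  set F := 1 + φ.momentSeries with hF
  set Q := substMul ρ.freeCumulant G' with hQ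
  have hG'nil : G' [] = 1 := ψ'.one_add_momentSeries_nil
  have hFnil : F [] = 1 := φ.one_add_momentSeries_nil
  -- The moment-cumulant equation of `ψ'`, with its free cumulants split into three summands.
  have hRψ' : G' = 1 + (substMul ψ.freeCumulant G' + (t : ℂ) • Q + G' * L) := by
    conv_lhs => rw [hG', ← substMul_freeCumulant ψ', ← hG', hψ', freeCumulant_freeConv,
      freeCumulant_freeConv, freeCumulant_freePow, freeCumulant_delta, substMul_add, substMul_add,
      substMul_smul, substMul_linearSeries]
  have hRψ : G = 1 + substMul ψ.freeCumulant G := by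
    rw [hG, substMul_freeCumulant]
  have hRφ : substMul φ.freeCumulant F = F - 1 := by
    rw [hF, substMul_freeCumulant, add_sub_cancel_left]
  have hη : G * φ.boolCumulant = substMul ρ.freeCumulant G :=
    one_add_momentSeries_mul_boolCumulant_Phi ρ ψ
  have hFη : F * (1 - φ.boolCumulant) = 1 := φ.one_add_momentSeries_mul
  -- `A` turns out to be `G(H w)`
  obtain ⟨A, hA⟩ : ∃ A, A = G' - (t : ℂ) • Q - G' * L := ⟨_, rfl⟩
  have hA' : A = 1 + substMul ψ.freeCumulant G' := by
    rw [hA, sub_sub, sub_eq_iff_eq_add]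
    conv_lhs => rw [hRψ']
    abel
  have hAnil : A [] = 1 := by
    rw [hA', add_apply, substMul_nil, freeCumulant_nil]; simp [one_apply]
  have hAu : IsUnit A := isUnit_of_nil_eq_one hAnil
  obtain ⟨H, hAH⟩ : ∃ H, A * H = G' :=
    ⟨Ring.inverse A * G', by rw [← mul_assoc, Ring.mul_inverse_cancel _ hAu, one_mul]⟩
  have hHnil : H [] = 1 := by
    have := congrArg (fun S : NCSeries d => S []) hAH
    simpa only [mul_nil, hAnil, one_mul, hG'nil] using this
  -- Both series solve `K = 1 + substMul ψ.freeCumulant (K * H)`.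
  have hGH : substMul G H = A := by
    refine eq_of_eq_one_add_substMul (R := ψ.freeCumulant) (H := H) ?_ (by rw [hAH]; exact hA')
    conv_lhs => rw [hRψ]
    rw [substMul_add, substMul_one, substMul_substMul]
  set f := substMul F H with hf
  set e := substMul φ.boolCumulant H with he
  have hfnil : f [] = 1 := by rw [hf, substMul_nil, hFnil]
  have hfe : f * (1 - e) = 1 := by
    rw [hf, he, ← substMul_one H, ← substMul_sub, ← substMul_mul, hFη]
  have hAe : A * e = Q := by
    rw [← hGH, he, ← substMul_mul, hη, substMul_substMul, hGH, hAH]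
  -- After multiplication by `A` on the left this is the definition of `A`.
  have hHL : H - H * L = 1 + (t : ℂ) • e := by
    apply hAu.mul_left_cancel
    rw [mul_sub, ← mul_assoc, hAH, mul_add, NCSeries.mul_smul', hAe, mul_one, hA]
    abel
  have hfe' : f * e = f - 1 := by
    rw [mul_sub, mul_one] at hfe
    rw [← hfe, sub_sub_cancel]
  have hfH : f * H - 1 = ((1 + t : ℝ) : ℂ) • (f - 1) + f * H * L := by
    have h : f * (H - H * L) = f + (t : ℂ) • (f - 1) := by
      rw [hHL, mul_add, mul_one, NCSeries.mul_smul', hfe']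
    rw [mul_sub, ← mul_assoc, sub_eq_iff_eq_add] at h
    rw [sub_eq_iff_eq_add, Complex.ofReal_add, Complex.ofReal_one, add_smul, one_smul]
    exact h.trans (by abel)
  -- Substituting `H w` for `w` in the equation of `φ` gives f - 1 = R^φ(f H w), so `hfH` is the
  -- fixed-point equation with cumulants (1+t)R^φ + L.
  have hσ : ((φ.freePow (1 + t)).freeConv (delta a)).momentSeries = f * H - 1 := by
    apply momentSeries_eq_of_substMul
    · rw [NCSeries.sub_apply, mul_nil, hfnil, hHnil]; simp [one_apply]
    · rw [freeCumulant_freeConv, freeCumulant_freePow, freeCumulant_delta, add_sub_cancel,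
        substMul_add, substMul_smul, substMul_linearSeries, ← substMul_substMul, hRφ,
        substMul_sub, substMul_one, ← hf, hfH]
  have hbool : G' * ((φ.freePow (1 + t)).freeConv (delta a)).boolCumulant
      = G' - A + Q := by
    have h := ((φ.freePow (1 + t)).freeConv (delta a)).one_add_momentSeries_mul
    rw [hσ, add_sub_cancel, mul_assoc] at h
    have hfu : IsUnit f := isUnit_of_nil_eq_one hfnil
    -- Cancelling `f` from f H (1 - η^σ) = 1 = f (1 - e) leaves H (1 - η^σ) = 1 - e; multiplying by
    -- `A` brings back G' and Q.
    have h' := hfu.mul_left_cancel (h.trans hfe.symm)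
    have h'' := congrArg (A * ·) h'
    simp only [← mul_assoc, hAH, mul_sub, mul_one, hAe] at h''
    rw [sub_eq_iff_eq_add, ← sub_eq_iff_eq_add'] at h''
    rw [← h'']
    abel
  have ht' : ((1 + t : ℝ) : ℂ) ≠ 0 := by
    rw [Complex.ofReal_ne_zero]
    exact fun h => ht (by linarith)
  rw [BTwo, boolCumulant_boolPow, boolCumulant_boolConv, boolCumulant_delta, linearSeries_neg,
    NCSeries.mul_smul', mul_add, hbool, hA]
  have h : G' - (G' - (t : ℂ) • Q - G' * L) + Q + G' * -linearSeries a
      = ((1 + t : ℝ) : ℂ) • Q := by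
    push_cast
    rw [add_smul, one_smul, mul_neg, ← hL]
    abel
  rw [h, smul_smul, Complex.ofReal_div, Complex.ofReal_one, one_div_mul_cancel ht', one_smul]

theorem Phi_freeConv_freePow (ρ ψ : NCFunctional d) {t : ℝ} (ht : t ≠ -1) :
    ρ.Phi (ψ.freeConv (ρ.freePow t)) = (ρ.Phi ψ).BOne t := by
  rw [← BTwo_zero, ← Phi_freeConv_freePow_delta ρ ψ 0 ht]
  refine congrArg ρ.Phi (ext_freeCumulant ?_)
  rw [freeCumulant_freeConv _ (delta 0), freeCumulant_delta, linearSeries_zero, add_zero]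

theorem condFreeCumulant_BOne {ρ ψ φ : NCFunctional d} {t : ℝ} (ht : t ≠ -1)
    (h : φ.condFreeCumulant ψ = ρ.freeCumulant) :
    (φ.BOne t).condFreeCumulant (ψ.freeConv (ρ.freePow t)) = ρ.freeCumulant := by
  rw [condFreeCumulant_eq_iff] at h ⊢
  rw [h, Phi_freeConv_freePow ρ ψ ht]

theorem BTwo_Phi_eq_BOne (ρ ψ : NCFunctional d) (a : Fin d → ℝ) {t : ℝ} (ht : t ≠ -1) :
    (ρ.Phi ψ).BTwo a t = (ρ.Phi (ψ.freeConv (delta a))).BOne t := by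
  rw [← Phi_freeConv_freePow_delta ρ ψ a ht, ← Phi_freeConv_freePow ρ _ ht]
  refine congrArg ρ.Phi (ext_freeCumulant ?_)
  simp only [freeCumulant_freeConv]
  abel

theorem BTwo_Phi_eq_BTwo (ρ ψ : NCFunctional d) (a : Fin d → ℝ) {t : ℝ} (ht : t ≠ -1) :
    (ρ.Phi ψ).BTwo a t = (ρ.Phi (ψ.freeConv (ρ.freePow t))).BTwo a 0 := by
  rw [← Phi_freeConv_freePow_delta ρ ψ a ht, ← Phi_freeConv_freePow_delta ρ _ a (by norm_num)]
  -- The right-hand side was rewritten with parameter 0, where ρ^{⊞0} has zero free cumulants.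
  refine congrArg ρ.Phi (ext_freeCumulant ?_)
  simp only [freeCumulant_freeConv, freeCumulant_freePow, Complex.ofReal_zero, zero_smul, add_zero]

end NCFunctional

/-- The evolution equations for `Φ[ρ, ψ]`: first for a freely infinitely divisible state `ρ`, with
its free convolution semigroup `ρ_t = ρ^{⊞ t}`, `t ≥ 0`, and a state `ψ`; then for arbitrary unital
linear functionals `ρ`, `ψ` and all real `t` for which the expressions are defined. -/
theorem mainTheorem1 (d : ℕ) :
    (∀ ρ ψ : NCFunctional d, ρ.IsFreelyInfinitelyDivisible → ψ.IsState →
      ∀ (a : Fin d → ℝ) (t : ℝ), 0 ≤ t →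
        ((ρ.freePow t).freeConv (.delta a)).Phi ψ = ((ρ.Phi ψ).boolPow t).boolConv (.delta a) ∧
        ρ.Phi (ψ.freeConv (ρ.freePow t)) = (ρ.Phi ψ).BOne t ∧
        (∀ φ : NCFunctional d, φ.condFreeCumulant ψ = ρ.freeCumulant →
          (φ.BOne t).condFreeCumulant (ψ.freeConv (ρ.freePow t)) = φ.condFreeCumulant ψ ∧
          (φ.BOne t).condFreeCumulant (ψ.freeConv (ρ.freePow t)) = ρ.freeCumulant) ∧
        ρ.Phi ((ψ.freeConv (ρ.freePow t)).freeConv (.delta a)) = (ρ.Phi ψ).BTwo a t ∧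
        (ρ.Phi ψ).BTwo a t = (ρ.Phi (ψ.freeConv (.delta a))).BOne t ∧
        (ρ.Phi ψ).BTwo a t = (ρ.Phi (ψ.freeConv (ρ.freePow t))).BTwo a 0) ∧
    (∀ (ρ ψ : NCFunctional d) (a : Fin d → ℝ) (t : ℝ),
      ((ρ.freePow t).freeConv (.delta a)).Phi ψ = ((ρ.Phi ψ).boolPow t).boolConv (.delta a) ∧
      (t ≠ -1 →
        ρ.Phi (ψ.freeConv (ρ.freePow t)) = (ρ.Phi ψ).BOne t ∧
        (∀ φ : NCFunctional d, φ.condFreeCumulant ψ = ρ.freeCumulant →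
          (φ.BOne t).condFreeCumulant (ψ.freeConv (ρ.freePow t)) = φ.condFreeCumulant ψ ∧
          (φ.BOne t).condFreeCumulant (ψ.freeConv (ρ.freePow t)) = ρ.freeCumulant) ∧
        ρ.Phi ((ψ.freeConv (ρ.freePow t)).freeConv (.delta a)) = (ρ.Phi ψ).BTwo a t ∧
        (ρ.Phi ψ).BTwo a t = (ρ.Phi (ψ.freeConv (.delta a))).BOne t ∧
        (ρ.Phi ψ).BTwo a t = (ρ.Phi (ψ.freeConv (ρ.freePow t))).BTwo a 0)) := by
  have key : ∀ (ρ ψ : NCFunctional d) (a : Fin d → ℝ) (t : ℝ), t ≠ -1 →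
      ρ.Phi (ψ.freeConv (ρ.freePow t)) = (ρ.Phi ψ).BOne t ∧
      (∀ φ : NCFunctional d, φ.condFreeCumulant ψ = ρ.freeCumulant →
        (φ.BOne t).condFreeCumulant (ψ.freeConv (ρ.freePow t)) = φ.condFreeCumulant ψ ∧
        (φ.BOne t).condFreeCumulant (ψ.freeConv (ρ.freePow t)) = ρ.freeCumulant) ∧
      ρ.Phi ((ψ.freeConv (ρ.freePow t)).freeConv (.delta a)) = (ρ.Phi ψ).BTwo a t ∧
      (ρ.Phi ψ).BTwo a t = (ρ.Phi (ψ.freeConv (.delta a))).BOne t ∧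
      (ρ.Phi ψ).BTwo a t = (ρ.Phi (ψ.freeConv (ρ.freePow t))).BTwo a 0 :=
    fun ρ ψ a t ht => ⟨NCFunctional.Phi_freeConv_freePow ρ ψ ht,
      fun φ hφ => ⟨(NCFunctional.condFreeCumulant_BOne ht hφ).trans hφ.symm,
        NCFunctional.condFreeCumulant_BOne ht hφ⟩,
      NCFunctional.Phi_freeConv_freePow_delta ρ ψ a ht,
      NCFunctional.BTwo_Phi_eq_BOne ρ ψ a ht, NCFunctional.BTwo_Phi_eq_BTwo ρ ψ a ht⟩
  exact ⟨fun ρ ψ _ _ a t ht => ⟨NCFunctional.Phi_freeConv_delta ρ ψ a t,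
      key ρ ψ a t (by linarith)⟩,
    fun ρ ψ a t => ⟨NCFunctional.Phi_freeConv_delta ρ ψ a t, key ρ ψ a t⟩⟩
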